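/- Let $k$ be a local field, i.e. a Hausdorff, locally compact, non-discrete topological field, and let $n\ge 0$. Let $\mathrm{Bir}(\mathbb P^n_k)$ be the group of birational maps of $\mathbb P^n_k$, endowed with the Euclidean topology, defined as follows. For $d\ge 1$ let $W_d(k)$ be the projective space of non-zero $(n+1)$-tuples of homogeneous polynomials of degree $d$ in $k[x_0,\dots,x_n]$ up to scalars, with its classical topology coming from $k$, and let $H_d(k)\subseteq W_d(k)$ be the subspace of those $[h_0:\dots:h_n]$ for which the rational map $[x_0:\dots:x_n]\dashrightarrow[h_0(x):\dots:h_n(x)]$ is birational; the set $\mathrm{Bir}(\mathbb P^n_k)_{\le d}$ of birational maps of degree at most $d$ carries the quotient topology with respect to $H_d(k)\to\mathrm{Bir}(\mathbb P^n_k)_{\le d}$, and $\mathrm{Bir}(\mathbb P^n_k)$ carries the inductive limit topology of the $\mathrm{Bir}(\mathbb P^n_k)_{\le d}$, $d\ge1$. The set of rational points $\mathbb P^n(k)$ is endowed with the quotient topology of $k^{n+1}\setminus\{0\}$. Let $(f_m)_{m\in\mathbb N}$ be a sequence in $\mathrm{Bir}(\mathbb P^n_k)$ that converges to $f\in\mathrm{Bir}(\mathbb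 P^n_k)$. Then, after replacing $(f_m)$ by a subsequence, there is a non-empty open subset $\Omega\subseteq\mathbb P^n(k)$ such that 1. $f$ is regular at every point of $\Omega$, and for all sufficiently large $m$ so is $f_m$; 2. the sequence of continuous maps $f_m|_\Omega:\Omega\to\mathbb P^n(k)$ (for $m$ large) converges to $f|_\Omega$ in the compact-open topology on the space of continuous maps $\Omega\to\mathbb P^n(k)$; and, with respect to any metric on $\mathbb P^n(k)$ inducing its topology, it converges to $f|_\Omega$ locally uniformly, i.e. every point of $\Omega$ has an open neighbourhood in $\Omega$ on which the convergence is uniform. -/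

import Mathlib

open Filter Topology
open scoped LinearAlgebra.Projectivization

noncomputable section

namespace Cremona

/-! ### Euclidean topologies on projective spaces -/

/-- The Euclidean topology on the projective space of a topological vector space `V`: the quotient
topology of `V \ {0}`. -/
instance projTopology (k V : Type*) [DivisionRing k] [AddCommGroup V] [Module k V]
    [TopologicalSpace V] : TopologicalSpace (ℙ k V) :=
  TopologicalSpace.coinduced (fun v : {v : V // v ≠ 0} => Projectivization.mk k v.1 v.2)
    inferInstance

/-- The set of `k`-rational points of `n`-dimensional projective space. -/
abbrev PP (k : Type*) [Field k] (n : ℕ) : Type _ := ℙ k (Fin (n + 1) → k)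

/-- The space of homogeneous polynomials of degree `d` in `x_0, …, x_n`. -/
abbrev Form (k : Type*) [Field k] (n d : ℕ) : Type _ :=
  MvPolynomial.homogeneousSubmodule (Fin (n + 1)) k d

/-- The Euclidean topology on the space of forms: the topology of the coefficients. -/
instance formTopology (k : Type*) [Field k] [TopologicalSpace k] (n d : ℕ) :
    TopologicalSpace (Form k n d) :=
  TopologicalSpace.induced
    (fun (p : Form k n d) (e : Fin (n + 1) →₀ ℕ) => MvPolynomial.coeff e p.1) inferInstance

/-- The space of `(n+1)`-tuples of forms of degree `d`. -/
abbrev Tuple (k : Type*) [Field k] (n d : ℕ) : Type _ := Fin (n + 1) → Form k n d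

/-! ### Rational maps of projective space -/

section RationalMaps

variable (k : Type*) [Field k] (n : ℕ)

/-- A non-zero tuple `(F_0, …, F_n)` of forms of some common degree. -/
structure Rep where
  deg : ℕ
  form : Tuple k n deg
  ne_zero : form ≠ 0

variable {k n}

/-- Two tuples of polynomials are proportional (over the function field) if all their `2 × 2` minors
vanish. -/
def Proportional (F G : Fin (n + 1) → MvPolynomial (Fin (n + 1)) k) : Prop :=
  ∀ i j, F i * G j = F j * G i

/-- The underlying tuple of polynomials. -/
def Rep.poly (F : Rep k n) : Fin (n + 1) → MvPolynomial (Fin (n + 1)) k := fun i => (F.form i).1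

theorem Rep.poly_ne_zero (F : Rep k n) : F.poly ≠ 0 := fun h =>
  F.ne_zero (funext fun i => Subtype.ext (congrFun h i))

theorem Proportional.symm {F G : Fin (n + 1) → MvPolynomial (Fin (n + 1)) k}
    (h : Proportional F G) : Proportional G F := fun i j => by
  rw [mul_comm (G i), mul_comm (G j)]; exact (h j i)

theorem Proportional.trans {F G H : Fin (n + 1) → MvPolynomial (Fin (n + 1)) k} (hG : G ≠ 0)
    (h₁ : Proportional F G) (h₂ : Proportional G H) : Proportional F H := fun i j => by
  obtain ⟨l, hl⟩ := Function.ne_iff.1 hG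
  have hl' : G l ≠ 0 := hl
  refine mul_left_cancel₀ hl' ?_
  linear_combination H j * h₁ i l - H i * h₁ j l + F l * h₂ i j

/-- Two tuples define the same rational map if and only if they are proportional. -/
instance repSetoid (k : Type*) [Field k] (n : ℕ) : Setoid (Rep k n) where
  r F G := Proportional F.poly G.poly
  iseqv :=
    { refl := fun _ _ _ => mul_comm _ _
      symm := fun h => h.symm
      trans := fun {_ G _} h₁ h₂ => h₁.trans G.poly_ne_zero h₂ }

/-- Rational maps from `n`-dimensional projective space over `k` to itself, that is, non-zero tuples
of forms of a common degree up to proportionality. The class of `(F_0, …, F_n)` is the rational map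
`[x_0 : … : x_n] ⇢ [F_0(x) : … : F_n(x)]`. -/
def RatMap (k : Type*) [Field k] (n : ℕ) : Type _ := Quotient (repSetoid k n)

/-- The rational map defined by a tuple. -/
def Rep.toRatMap (F : Rep k n) : RatMap k n := Quotient.mk _ F

theorem Rep.toRatMap_eq_iff {F G : Rep k n} :
    F.toRatMap = G.toRatMap ↔ Proportional F.poly G.poly := Quotient.eq

/-- The tuple `F(G_0, …, G_n)` representing the composition `F ∘ G`, if it is non-zero. -/
def Rep.comp (F G : Rep k n) : Fin (n + 1) → MvPolynomial (Fin (n + 1)) k :=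
  fun i => MvPolynomial.bind₁ G.poly (F.poly i)

/-- The composition `F ∘ G` is defined and is the identity map `[x_0 : … : x_n]`. -/
def Rep.IsLeftInverse (F G : Rep k n) : Prop :=
  F.comp G ≠ 0 ∧ Proportional (F.comp G) MvPolynomial.X

/-- A rational map is birational if it has an inverse rational map. -/
def RatMap.IsBirational (f : RatMap k n) : Prop :=
  ∃ F G : Rep k n, F.toRatMap = f ∧ F.IsLeftInverse G ∧ G.IsLeftInverse F

/-- The degree of a rational map: the least degree of a tuple of forms that defines it. -/
def RatMap.degree (f : RatMap k n) : ℕ := sInf {d | ∃ F : Rep k n, F.deg = d ∧ F.toRatMap = f}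

/-- The Cremona group (as a set): the birational maps of `n`-dimensional projective space. -/
def Bir (k : Type*) [Field k] (n : ℕ) : Type _ := {f : RatMap k n // f.IsBirational}

/-- The birational maps of degree at most `d`. -/
def BirLE (k : Type*) [Field k] (n d : ℕ) : Type _ := {f : Bir k n // f.1.degree ≤ d}

/-- The inclusion of the birational maps of degree at most `d` into the Cremona group. -/
def BirLE.incl {d : ℕ} (f : BirLE k n d) : Bir k n := f.1

end RationalMaps

/-! ### The Euclidean topology on the Cremona group -/

/-- The projective space parametrising non-zero `(n+1)`-tuples of forms of degree `d` up to
scalars. -/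
abbrev W (k : Type*) [Field k] (n d : ℕ) : Type _ := ℙ k (Tuple k n d)

/-- The rational map defined by a point of `W k n d`. -/
def W.toRatMap {k : Type*} [Field k] {n d : ℕ} : W k n d → RatMap k n :=
  Projectivization.lift (fun v => Rep.toRatMap ⟨d, v.1, v.2⟩) (by
    rintro ⟨a, ha⟩ ⟨b, hb⟩ t (rfl : a = t • b)
    rw [Rep.toRatMap_eq_iff]
    intro i j
    simp only [Rep.poly, Pi.smul_apply, Submodule.coe_smul, smul_mul_assoc]
    rw [mul_comm (b i).1])

/-- The set of points of `W k n d` that define a birational map, with the subspace topology. -/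
abbrev H (k : Type*) [Field k] (n d : ℕ) : Type _ := {h : W k n d // h.toRatMap.IsBirational}

theorem W.degree_toRatMap_le {k : Type*} [Field k] {n d : ℕ} (h : W k n d) :
    h.toRatMap.degree ≤ d := by
  refine Projectivization.ind (P := fun h : W k n d => h.toRatMap.degree ≤ d) (fun v hv => ?_) h
  exact Nat.sInf_le ⟨⟨d, v, hv⟩, rfl, rfl⟩

/-- The map that sends a point of `H k n d` to the birational map that it defines. -/
def piMap (k : Type*) [Field k] (n d : ℕ) (h : H k n d) : BirLE k n d :=
  ⟨⟨h.1.toRatMap, h.2⟩, h.1.degree_toRatMap_le⟩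

/-- The Euclidean topology on the set of birational maps of degree at most `d`: the quotient
topology of `H k n d`. -/
instance birLETopology (k : Type*) [Field k] [TopologicalSpace k] (n d : ℕ) :
    TopologicalSpace (BirLE k n d) :=
  TopologicalSpace.coinduced (piMap k n d) inferInstance

/-- The Euclidean topology on the Cremona group: the inductive limit topology of the sets of
birational maps of degree at most `d`, for `d ≥ 1`. -/
instance birTopology (k : Type*) [Field k] [TopologicalSpace k] (n : ℕ) :
    TopologicalSpace (Bir k n) :=
  ⨆ d : {d : ℕ // 1 ≤ d},
    TopologicalSpace.coinduced (BirLE.incl (k := k) (n := n) (d := d.1)) inferInstance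

/-! ### Regular points and values -/

section Regular

variable {k : Type*} [Field k] {n : ℕ}

/-- The value of a tuple of forms at a vector. -/
def Rep.eval (F : Rep k n) (x : Fin (n + 1) → k) : Fin (n + 1) → k :=
  fun i => MvPolynomial.eval x (F.poly i)

/-- A rational map is regular at a rational point `p` if it is defined by some tuple of forms that
does not vanish at `p`. -/
def RatMap.RegularAt (f : RatMap k n) (p : PP k n) : Prop :=
  ∃ F : Rep k n, F.toRatMap = f ∧ F.eval p.rep ≠ 0

/-- The value `[F_0(p) : … : F_n(p)]` of a rational map at a point `p` where it is regular; here `F`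
is any tuple defining the map that does not vanish at `p`, see `RatMap.value_eq`. -/
def RatMap.value (f : RatMap k n) (p : PP k n) (h : f.RegularAt p) : PP k n :=
  Projectivization.mk k (h.choose.eval p.rep) h.choose_spec.2

theorem Rep.eval_smul (F : Rep k n) (a : k) (x : Fin (n + 1) → k) :
    F.eval (a • x) = a ^ F.deg • F.eval x := by
  funext i
  have hF : (F.poly i).IsHomogeneous F.deg :=
    (MvPolynomial.mem_homogeneousSubmodule _ _).1 (F.form i).2
  simp only [Rep.eval, Pi.smul_apply, smul_eq_mul, MvPolynomial.eval_eq, Finset.mul_sum]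
  refine Finset.sum_congr rfl fun e he => ?_
  have hdeg : ∑ j ∈ e.support, e j = F.deg := by
    have := hF (MvPolynomial.mem_support_iff.1 he)
    simpa [Finsupp.weight_apply, Finsupp.sum] using this
  simp only [mul_pow, Finset.prod_mul_distrib,
    Finset.prod_pow_eq_pow_sum, hdeg]
  ring

theorem Rep.eval_rep_ne_zero_iff (F : Rep k n) (v : Fin (n + 1) → k) (hv : v ≠ 0) :
    F.eval (Projectivization.mk k v hv).rep ≠ 0 ↔ F.eval v ≠ 0 := by
  obtain ⟨a, ha⟩ := Projectivization.exists_smul_eq_mk_rep k v hv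
  have ha' : (a : k) • v = (Projectivization.mk k v hv).rep := ha
  rw [← ha', Rep.eval_smul, smul_ne_zero_iff_right (pow_ne_zero _ a.ne_zero)]

theorem RatMap.value_eq (F : Rep k n) (v : Fin (n + 1) → k) (hv : v ≠ 0) (hF : F.eval v ≠ 0)
    (h : F.toRatMap.RegularAt (Projectivization.mk k v hv)) :
    F.toRatMap.value (Projectivization.mk k v hv) h = Projectivization.mk k (F.eval v) hF := by
  obtain ⟨a, ha⟩ := Projectivization.exists_smul_eq_mk_rep k v hv
  have ha' : (a : k) • v = (Projectivization.mk k v hv).rep := ha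
  have main : ∀ (G : Rep k n) (hG : G.toRatMap = F.toRatMap ∧
      G.eval (Projectivization.mk k v hv).rep ≠ 0),
      Projectivization.mk k (G.eval (Projectivization.mk k v hv).rep) hG.2 =
        Projectivization.mk k (F.eval v) hF := ?_
  · exact main h.choose h.choose_spec
  intro G hG
  have hGF := Rep.toRatMap_eq_iff.1 hG.1
  have hGv : G.eval v ≠ 0 := (G.eval_rep_ne_zero_iff v hv).1 hG.2
  obtain ⟨l, hl⟩ := Function.ne_iff.1 hF
  have hl' : F.eval v l ≠ 0 := hl
  have key : ∀ i j, G.eval v i * F.eval v j = G.eval v j * F.eval v i := fun i j => by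
    simpa [Rep.eval] using congrArg (MvPolynomial.eval v) (hGF i j)
  rw [Projectivization.mk_eq_mk_iff']
  refine ⟨(a : k) ^ G.deg * (G.eval v l / F.eval v l), ?_⟩
  rw [← ha', Rep.eval_smul, mul_smul]
  congr 1
  funext i
  rw [Pi.smul_apply, smul_eq_mul, div_mul_eq_mul_div, div_eq_iff hl', key l i]

/-- A rational map is regular on a set of rational points if it is regular at each of them. -/
def RatMap.RegularOn (f : RatMap k n) (Ω : Set (PP k n)) : Prop := ∀ p ∈ Ω, f.RegularAt p

end Regular

theorem Rep.continuous_eval {k : Type*} [Field k] [TopologicalSpace k] [IsTopologicalRing k] {n : ℕ}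
    (F : Rep k n) : Continuous F.eval :=
  continuous_pi fun i => MvPolynomial.continuous_eval (F.poly i)

theorem continuous_mk {k V : Type*} [DivisionRing k] [AddCommGroup V] [Module k V]
    [TopologicalSpace V] :
    Continuous (fun v : {v : V // v ≠ 0} => Projectivization.mk k v.1 v.2) :=
  continuous_coinduced_rng

theorem isOpenMap_mk {k V : Type*} [DivisionRing k] [AddCommGroup V] [Module k V]
    [TopologicalSpace V] [ContinuousConstSMul k V] :
    IsOpenMap (fun v : {v : V // v ≠ 0} => Projectivization.mk k v.1 v.2) := by
  intro S hS
  obtain ⟨T, hT, rfl⟩ := hS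
  refine isOpen_coinduced.2 ?_
  have : (fun v : {v : V // v ≠ 0} => Projectivization.mk k v.1 v.2) ⁻¹'
      ((fun v : {v : V // v ≠ 0} => Projectivization.mk k v.1 v.2) '' (Subtype.val ⁻¹' T)) =
      ⋃ a : kˣ, Subtype.val ⁻¹' ((fun v : V => (a : k) • v) ⁻¹' T) := by
    ext ⟨v, hv⟩
    simp only [Set.mem_preimage, Set.mem_image, Set.mem_iUnion, Subtype.exists]
    constructor
    · rintro ⟨w, hw, hwT, h⟩
      obtain ⟨a, ha⟩ := (Projectivization.mk_eq_mk_iff k w v hw hv).1 h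
      refine ⟨a, ?_⟩
      change a • v ∈ T
      rwa [ha]
    · rintro ⟨a, ha⟩
      have hav : (a : k) • v ≠ 0 := smul_ne_zero a.ne_zero hv
      exact ⟨(a : k) • v, hav, ha, (Projectivization.mk_eq_mk_iff k _ _ hav hv).2 ⟨a, rfl⟩⟩
  rw [this]
  exact isOpen_iUnion fun a => (hT.preimage (continuous_const_smul _)).preimage continuous_subtype_val

theorem RatMap.continuous_value {k : Type*} [Field k] [TopologicalSpace k] [IsTopologicalRing k]
    [T2Space k] {n : ℕ} (f : RatMap k n) (Ω : Set (PP k n)) (h : f.RegularOn Ω) :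
    Continuous (fun p : Ω => f.value p.1 (h p.1 p.2)) := by
  rw [continuous_iff_continuousAt]
  rintro ⟨p, hp⟩
  obtain ⟨F, rfl, hFp⟩ := h p hp
  obtain ⟨v, hv, rfl⟩ : ∃ v, ∃ hv : v ≠ 0, p = Projectivization.mk k v hv :=
    ⟨p.rep, p.rep_nonzero, p.mk_rep.symm⟩
  have hFv : F.eval v ≠ 0 := (F.eval_rep_ne_zero_iff v hv).1 hFp
  intro N hN
  obtain ⟨N', hN'N, hN'o, hN'⟩ := mem_nhds_iff.1 hN
  have hval := RatMap.value_eq F v hv hFv (h _ hp)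
  have hN'' : Projectivization.mk k (F.eval v) hFv ∈ N' := hval ▸ hN'
  obtain ⟨T, hT, hTN⟩ := hN'o.preimage (continuous_mk (k := k) (V := Fin (n + 1) → k))
  have hT' : ∀ w (hw : w ≠ 0), w ∈ T ↔ Projectivization.mk k w hw ∈ N' := fun w hw =>
    Set.ext_iff.1 hTN ⟨w, hw⟩
  have hO := isOpenMap_mk (k := k) (V := Fin (n + 1) → k)
    (Subtype.val ⁻¹' (F.eval ⁻¹' (T ∩ {0}ᶜ)))
    (((hT.inter isOpen_compl_singleton).preimage F.continuous_eval).preimage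
      continuous_subtype_val)
  rw [Filter.mem_map]
  refine Filter.mem_of_superset ((hO.preimage continuous_subtype_val).mem_nhds
    (⟨⟨v, hv⟩, ⟨(hT' _ hFv).2 hN'', hFv⟩, rfl⟩ : _)) ?_
  rintro ⟨q, hq⟩ ⟨⟨w, hw⟩, ⟨hwT, hw0⟩, hwq⟩
  obtain rfl : Projectivization.mk k w hw = q := hwq
  refine hN'N ?_
  change F.toRatMap.value (Projectivization.mk k w hw) (h _ hq) ∈ N'
  rw [RatMap.value_eq F w hw hw0]
  exact (hT' _ hw0).1 hwT

/-- The restriction `f|_Ω` of a rational map to a set of rational points on which it is regular, as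
a continuous map. -/
def RatMap.restrict {k : Type*} [Field k] [TopologicalSpace k] [IsTopologicalRing k] [T2Space k]
    {n : ℕ} (f : RatMap k n) (Ω : Set (PP k n)) (h : f.RegularOn Ω) : C(Ω, PP k n) :=
  ⟨fun p => f.value p.1 (h p.1 p.2), f.continuous_value Ω h⟩

/-- A sequence of maps from a topological space to a metric space converges locally uniformly: each
point has an open neighbourhood on which the convergence is uniform. -/
def ConvergesLocallyUniformly {U V : Type*} [TopologicalSpace U] [MetricSpace V]
    (F : ℕ → U → V) (g : U → V) : Prop :=
  ∀ p : U, ∃ B : Set U, IsOpen B ∧ p ∈ B ∧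
    ∀ ε > 0, ∃ N : ℕ, ∀ m ≥ N, ∀ q ∈ B, dist (F m q) (g q) < ε

/-- Local uniform convergence with respect to every metric that induces the given topology of the
target. -/
def ConvergesLocallyUniformlyForAllMetrics {U V : Type*} [TopologicalSpace U]
    [tV : TopologicalSpace V] (F : ℕ → U → V) (g : U → V) : Prop :=
  ∀ δ : MetricSpace V, δ.toUniformSpace.toTopologicalSpace = tV →
    ConvergesLocallyUniformly (V := V) F g

end Cremona

end

namespace Cremona

/-! ### Locally compact topological fields and vector spaces over them -/

section LocalField

open scoped Pointwise

/-! The point is to lift a subsequence to convergent non-zero coefficient tuples of one degree;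
evaluation is then jointly continuous in the tuple and the point. A topologically nilpotent scalar
makes `k` first countable and gives, in each space of tuples, a compact set that avoids zero and
meets every line (`exists_isCompact_smul_mem`). Since proportionality is a closed condition, the
maps represented by a compact set of non-zero tuples form a closed subset of the Cremona group
(`isClosed_bir_of_isCompact`). Such closed sets contain the limit `f` as soon as they contain a tail
of the sequence. This bounds the degree along a subsequence, and it shows that the limit `w` of
normalised lifts represents `f` (`exists_subseq_tendsto_tuple`). A non-zero tuple over an infinite
field is non-zero at some point. Tuples near `w` then have no common zero on a compact neighbourhood
of that point, and currying gives compact-open convergence on its interior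
(`exists_isOpen_tendsto_restrict`). The tuples may have common factors, since regularity only asks
for some non-vanishing representative. -/

theorem eventually_smul_subset {k V : Type*} [Field k] [TopologicalSpace k] [AddCommGroup V]
    [Module k V] [TopologicalSpace V] [ContinuousSMul k V] {B O : Set V} (hB : IsCompact B)
    (hO : O ∈ 𝓝 (0 : V)) : ∀ᶠ a in 𝓝 (0 : k), ∀ v ∈ B, a • v ∈ O := by
  refine hB.eventually_forall_of_forall_eventually fun v _ => ?_
  have : Tendsto (fun z : k × V => z.1 • z.2) (𝓝 (0, v)) (𝓝 ((0 : k) • v)) :=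
    continuous_smul.tendsto _
  rw [zero_smul] at this
  exact this.eventually hO

theorem infinite_of_not_discrete {k : Type*} [TopologicalSpace k] [T2Space k]
    (hk : ¬ DiscreteTopology k) : Infinite k := by
  by_contra h
  rw [not_infinite_iff_finite] at h
  exact hk inferInstance

variable {k : Type*} [Field k] [TopologicalSpace k] [IsTopologicalDivisionRing k]

theorem exists_ne_zero_mem_of_mem_nhds_zero (hk : ¬ DiscreteTopology k) {U : Set k}
    (hU : U ∈ 𝓝 (0 : k)) : ∃ t ∈ U, t ≠ 0 := by
  by_contra! h
  refine hk (discreteTopology_of_isOpen_singleton_zero ?_)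
  rw [isOpen_singleton_iff_nhds_eq_pure]
  refine le_antisymm (fun S hS => ?_) (pure_le_nhds 0)
  exact mem_of_superset hU fun t ht => by rw [h t ht]; exact hS

/-- A locally compact, non-discrete Hausdorff field contains a non-zero topologically nilpotent
element. -/
theorem exists_tendsto_pow_zero [T2Space k] [LocallyCompactSpace k] (hk : ¬ DiscreteTopology k) :
    ∃ t : k, t ≠ 0 ∧ Tendsto (fun m : ℕ => t ^ m) atTop (𝓝 0) := by
  obtain ⟨U₀, hU₀, hU₀n⟩ := exists_compact_mem_nhds (0 : k)
  set U : Set k := insert 1 U₀ with hUdef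
  have hU : IsCompact U := hU₀.insert 1
  have hUn : U ∈ 𝓝 (0 : k) := mem_of_superset hU₀n (Set.subset_insert _ _)
  have hU1 : (1 : k) ∈ U := Set.mem_insert _ _
  -- Choose `t` with `t * U ⊆ U \ {1}`: staying in `U` confines all powers to a compact set, and
  -- missing `1` excludes non-zero cluster points.
  have hO : U \ {1} ∈ 𝓝 (0 : k) :=
    inter_mem hUn (isOpen_compl_singleton.mem_nhds (by simp))
  obtain ⟨t, ht, ht0⟩ :=
    exists_ne_zero_mem_of_mem_nhds_zero hk (eventually_smul_subset (k := k) hU hO)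
  replace ht : ∀ v ∈ U, t * v ∈ U \ {1} := ht
  have hpow : ∀ m : ℕ, t ^ m ∈ U := by
    intro m
    induction m with
    | zero => simpa using hU1
    | succ m ih => rw [pow_succ']; exact (ht _ ih).1
  refine ⟨t, ht0, hU.tendsto_nhds_of_unique_mapClusterPt (Eventually.of_forall hpow) ?_⟩
  intro a _ ha
  by_contra ha0
  -- Two powers near `a ≠ 0` have quotient near `1`; but for `l > m` the quotient `t ^ l / t ^ m`
  -- lies in the closed set `t * U`, which misses `1`.
  have hclosed : IsClosed ((fun v => t * v) '' U) := (hU.image (continuous_const_mul t)).isClosed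
  have h1 : (1 : k) ∉ (fun v => t * v) '' U := by
    rintro ⟨v, hv, hv1⟩
    exact (ht v hv).2 hv1
  have hdiv : Tendsto (fun z : k × k => z.1 / z.2) (𝓝 (a, a)) (𝓝 (a / a)) :=
    (continuousAt_fst.div continuousAt_snd ha0 : ContinuousAt _ (a, a))
  rw [div_self ha0, nhds_prod_eq] at hdiv
  obtain ⟨N, hN, hNd⟩ := mem_prod_self_iff.1 (hdiv (hclosed.isOpen_compl.mem_nhds h1))
  have hfreq := (mapClusterPt_iff_frequently.1 ha) N hN
  obtain ⟨m, -, hm⟩ := frequently_atTop.1 hfreq 0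
  obtain ⟨l, hl, hl'⟩ := frequently_atTop.1 hfreq (m + 1)
  have := hNd (Set.mk_mem_prod hl' hm)
  refine this ⟨t ^ (l - m - 1), hpow _, ?_⟩
  change t * t ^ (l - m - 1) = t ^ l / t ^ m
  rw [eq_div_iff (pow_ne_zero _ ht0), ← pow_succ', ← pow_add]
  congr 1
  omega

/-- The sets `t ^ m • U`, for one compact neighbourhood `U`, shrink into every neighbourhood of
zero. -/
theorem isCountablyGenerated_nhds_zero [T2Space k] [LocallyCompactSpace k]
    (hk : ¬ DiscreteTopology k) : (𝓝 (0 : k)).IsCountablyGenerated := by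
  obtain ⟨t, ht0, ht⟩ := exists_tendsto_pow_zero hk
  obtain ⟨U, hU, hUn⟩ := exists_compact_mem_nhds (0 : k)
  have hb : (𝓝 (0 : k)).HasBasis (fun _ : ℕ => True) fun m => t ^ m • U := by
    refine ⟨fun O => ⟨fun hO => ?_, ?_⟩⟩
    · obtain ⟨m, hm⟩ := (ht.eventually (eventually_smul_subset (k := k) hU hO)).exists
      refine ⟨m, trivial, ?_⟩
      rintro _ ⟨v, hv, rfl⟩
      exact hm v hv
    · rintro ⟨m, -, hm⟩
      exact mem_of_superset ((set_smul_mem_nhds_zero_iff (pow_ne_zero m ht0)).2 hUn) hm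
  exact hb.isCountablyGenerated

theorem firstCountableTopology_of_not_discrete [T2Space k] [LocallyCompactSpace k]
    (hk : ¬ DiscreteTopology k) : FirstCountableTopology k where
  nhds_generated_countable a := by
    have := isCountablyGenerated_nhds_zero hk
    have h := map_add_left_nhds_zero a
    rw [← h]
    infer_instance

/-- In a locally compact vector space, the non-zero vectors can be scaled into a compact set that
does not contain zero. -/
theorem exists_isCompact_smul_mem [T2Space k] [LocallyCompactSpace k] (hk : ¬ DiscreteTopology k)
    (V : Type*) [AddCommGroup V] [Module k V] [TopologicalSpace V] [ContinuousSMul k V] [T2Space V]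
    [LocallyCompactSpace V] :
    ∃ C : Set V, IsCompact C ∧ 0 ∉ C ∧ ∀ v : V, v ≠ 0 → ∃ a : k, a ≠ 0 ∧ a • v ∈ C := by
  obtain ⟨t, ht0, ht⟩ := exists_tendsto_pow_zero hk
  obtain ⟨B, hB, hBn⟩ := exists_compact_mem_nhds (0 : V)
  -- An annulus: scale `v` into `B` by `t ^ j`, then divide by the last `t ^ m` before the vector
  -- first leaves the sets `t ^ m • B`. The result is in `B` but not in `t • B`.
  refine ⟨B \ interior (t • B), hB.diff isOpen_interior, fun h => h.2 ?_, fun v hv => ?_⟩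
  · exact mem_interior_iff_mem_nhds.2 ((set_smul_mem_nhds_zero_iff ht0).2 hBn)
  have hcont : Tendsto (fun m : ℕ => t ^ m • v) atTop (𝓝 ((0 : k) • v)) := ht.smul_const v
  rw [zero_smul] at hcont
  obtain ⟨j, hj⟩ : ∃ j : ℕ, t ^ j • v ∈ B := (hcont.eventually hBn).exists
  have hw : t ^ j • v ≠ 0 := smul_ne_zero (pow_ne_zero _ ht0) hv
  have hex : ∃ m : ℕ, t ^ j • v ∉ t ^ m • B := by
    obtain ⟨m, hm⟩ := (ht.eventually (eventually_smul_subset (k := k) hB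
      (isOpen_compl_singleton.mem_nhds hw.symm))).exists
    exact ⟨m, fun ⟨u, hu, hu'⟩ => hm u hu hu'⟩
  classical
  obtain ⟨m, hm, hmin⟩ : ∃ m, t ^ j • v ∉ t ^ m • B ∧ ∀ l < m, t ^ j • v ∈ t ^ l • B :=
    ⟨Nat.find hex, Nat.find_spec hex, fun l hl => not_not.1 (Nat.find_min hex hl)⟩
  cases m with
  | zero => exact absurd (by simpa using hj) hm
  | succ m =>
    obtain ⟨u, hu, hu'⟩ := hmin m m.lt_succ_self
    replace hu' : t ^ m • u = t ^ j • v := hu'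
    have hmu : ((t ^ m)⁻¹ * t ^ j) • v = u := by
      rw [mul_smul, ← hu', inv_smul_smul₀ (pow_ne_zero _ ht0)]
    refine ⟨(t ^ m)⁻¹ * t ^ j,
      mul_ne_zero (inv_ne_zero (pow_ne_zero _ ht0)) (pow_ne_zero _ ht0), ?_⟩
    rw [hmu]
    refine ⟨hu, fun h => hm ?_⟩
    obtain ⟨x, hx, hx'⟩ := interior_subset h
    refine ⟨x, hx, ?_⟩
    replace hx' : t • x = u := hx'
    change t ^ (m + 1) • x = t ^ j • v
    rw [← hu', ← hx', smul_smul, pow_succ]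

end LocalField

/-! ### Topology of spaces of forms -/

section Forms

variable {k : Type*} [Field k] {n d : ℕ}

/-- The exponents of the monomials of degree `d` in `x_0, …, x_n`. -/
abbrev exponents (n d : ℕ) : Finset (Fin (n + 1) →₀ ℕ) := Finset.univ.finsuppAntidiag d

theorem mem_exponents {e : Fin (n + 1) →₀ ℕ} : e ∈ exponents n d ↔ e.degree = d := by
  simp [Finset.mem_finsuppAntidiag, Finsupp.degree_eq_sum]

theorem Form.coeff_eq_zero (p : Form k n d) {e : Fin (n + 1) →₀ ℕ} (he : e ∉ exponents n d) :
    MvPolynomial.coeff e p.1 = 0 := by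
  by_contra h
  have hp : p.1.IsHomogeneous d := (MvPolynomial.mem_homogeneousSubmodule _ _).1 p.2
  refine he (mem_exponents.2 ?_)
  by_contra hd
  exact h (hp.coeff_eq_zero hd)

/-- The index set no longer depends on `p`, so continuity in the coefficients can be read off
termwise. -/
theorem Form.eval_eq_sum (p : Form k n d) (x : Fin (n + 1) → k) :
    MvPolynomial.eval x p.1 =
      ∑ e ∈ exponents n d, MvPolynomial.coeff e p.1 * ∏ i, x i ^ e i := by
  rw [MvPolynomial.eval_eq']
  refine Finset.sum_subset (fun e he => ?_) fun e _ he => ?_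
  · by_contra h
    exact MvPolynomial.mem_support_iff.1 he (p.coeff_eq_zero h)
  · rw [MvPolynomial.notMem_support_iff.1 he, zero_mul]

/-- The linear map that sends a form to its coefficients. -/
noncomputable def Form.coeffs (k : Type*) [Field k] (n d : ℕ) :
    Form k n d →ₗ[k] ((Fin (n + 1) →₀ ℕ) → k) where
  toFun p e := MvPolynomial.coeff e p.1
  map_add' _ _ := rfl
  map_smul' _ _ := rfl

variable [TopologicalSpace k]

theorem Form.isInducing_coeffs : IsInducing (Form.coeffs k n d) := ⟨rfl⟩

theorem Form.continuous_coeff (e : Fin (n + 1) →₀ ℕ) :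
    Continuous fun p : Form k n d => MvPolynomial.coeff e p.1 :=
  (continuous_apply e).comp Form.isInducing_coeffs.continuous

instance Form.continuousSMul [ContinuousMul k] : ContinuousSMul k (Form k n d) :=
  continuousSMul_induced (Form.coeffs k n d)

/-- Only the finitely many coefficients of degree `d` can be non-zero, and extension by zero
recovers the others continuously. Topological properties of finite powers of `k` thus pass to forms.
-/
theorem Form.isClosedEmbedding_coeffs :
    IsClosedEmbedding fun (p : Form k n d) (e : exponents n d) => MvPolynomial.coeff e.1 p.1 := by
  classical
  have hcont : Continuous fun (p : Form k n d) (e : exponents n d) => MvPolynomial.coeff e.1 p.1 :=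
    continuous_pi fun e => Form.continuous_coeff e.1
  have hext : Continuous fun (c : exponents n d → k) (e : Fin (n + 1) →₀ ℕ) =>
      if he : e ∈ exponents n d then c ⟨e, he⟩ else 0 := by
    refine continuous_pi fun e => ?_
    by_cases he : e ∈ exponents n d
    · simpa only [he, dite_true] using continuous_apply _
    · simpa only [he, dite_false] using continuous_const
  have hcomp : (fun (c : exponents n d → k) (e : Fin (n + 1) →₀ ℕ) =>
      if he : e ∈ exponents n d then c ⟨e, he⟩ else 0) ∘
        (fun (p : Form k n d) (e : exponents n d) => MvPolynomial.coeff e.1 p.1) =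
      Form.coeffs k n d := by
    funext p e
    by_cases he : e ∈ exponents n d
    · simp only [Function.comp_apply, he, dite_true]
      rfl
    · simp only [Function.comp_apply, he, dite_false]
      exact (p.coeff_eq_zero he).symm
  have hind : IsInducing fun (p : Form k n d) (e : exponents n d) => MvPolynomial.coeff e.1 p.1 :=
    .of_comp hcont hext (hcomp ▸ Form.isInducing_coeffs)
  refine ⟨⟨hind, fun p q hpq => ?_⟩, ?_⟩
  · refine Subtype.ext (MvPolynomial.ext _ _ fun e => ?_)
    by_cases he : e ∈ exponents n d
    · exact congrFun hpq ⟨e, he⟩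
    · rw [p.coeff_eq_zero he, q.coeff_eq_zero he]
  · rw [Function.Surjective.range_eq]
    · exact isClosed_univ
    intro c
    refine ⟨⟨∑ e : exponents n d, MvPolynomial.monomial e.1 (c e), ?_⟩, ?_⟩
    · refine Submodule.sum_mem _ fun e _ => ?_
      exact MvPolynomial.isHomogeneous_monomial _ (mem_exponents.1 e.2)
    · funext e
      simp only [MvPolynomial.coeff_sum, MvPolynomial.coeff_monomial]
      rw [Finset.sum_eq_single e]
      · simp
      · intro b _ hb
        rw [if_neg fun h => hb (Subtype.ext h)]
      · simp

instance Form.t2Space [T2Space k] : T2Space (Form k n d) :=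
  Form.isClosedEmbedding_coeffs.isEmbedding.t2Space

instance Form.locallyCompactSpace [LocallyCompactSpace k] : LocallyCompactSpace (Form k n d) :=
  Form.isClosedEmbedding_coeffs.locallyCompactSpace

instance Form.firstCountableTopology [FirstCountableTopology k] :
    FirstCountableTopology (Form k n d) :=
  Form.isClosedEmbedding_coeffs.isInducing.firstCountableTopology

/-- The value of a tuple of forms at a vector. -/
noncomputable def Tuple.eval (v : Tuple k n d) (x : Fin (n + 1) → k) : Fin (n + 1) → k :=
  fun i => MvPolynomial.eval x (v i).1

theorem Tuple.continuous_eval [IsTopologicalRing k] {X : Type*} [TopologicalSpace X]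
    {f : X → Tuple k n d} {g : X → Fin (n + 1) → k} (hf : Continuous f) (hg : Continuous g) :
    Continuous fun x => (f x).eval (g x) := by
  refine continuous_pi fun i => ?_
  simp only [Tuple.eval, Form.eval_eq_sum]
  refine continuous_finsetSum _ fun e _ => ?_
  have hfe : Continuous fun x => MvPolynomial.coeff e (f x i).1 :=
    (Form.continuous_coeff e).comp (continuous_pi_iff.1 hf i)
  exact hfe.mul (continuous_finsetProd _ fun j _ => (continuous_pi_iff.1 hg j).pow _)

theorem isClosed_proportional [IsTopologicalRing k] [T2Space k] {d' : ℕ} :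
    IsClosed {z : Tuple k n d × Tuple k n d' |
      Proportional (fun i => (z.1 i).1) (fun i => (z.2 i).1)} := by
  have hc : ∀ (e : Fin (n + 1) →₀ ℕ) (i j : Fin (n + 1)), Continuous
      fun z : Tuple k n d × Tuple k n d' => MvPolynomial.coeff e ((z.1 i).1 * (z.2 j).1) := by
    intro e i j
    simp only [MvPolynomial.coeff_mul]
    refine continuous_finsetSum _ fun s _ => ?_
    have h₁ : Continuous fun z : Tuple k n d × Tuple k n d' => z.1 i :=
      continuous_pi_iff.1 continuous_fst i
    have h₂ : Continuous fun z : Tuple k n d × Tuple k n d' => z.2 j :=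
      continuous_pi_iff.1 continuous_snd j
    exact ((Form.continuous_coeff s.1).comp h₁).mul ((Form.continuous_coeff s.2).comp h₂)
  simp only [Proportional, MvPolynomial.ext_iff, Set.ofPred_forall]
  exact isClosed_iInter fun i => isClosed_iInter fun j => isClosed_iInter fun e =>
    isClosed_eq (hc e i j) (hc e j i)

/-- Projection along the compact factor `K` preserves closedness. -/
theorem isClosed_exists_proportional [IsTopologicalRing k] [T2Space k] {d' : ℕ}
    {K : Set (Tuple k n d')} (hK : IsCompact K) :
    IsClosed {v : Tuple k n d | ∃ w ∈ K, Proportional (fun i => (v i).1) (fun i => (w i).1)} := by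
  rw [← isOpen_compl_iff, isOpen_iff_mem_nhds]
  intro v hv
  simp only [Set.mem_compl_iff, Set.mem_ofPred_eq, not_exists, not_and] at hv
  have := hK.eventually_forall_of_forall_eventually (x₀ := v) (P := fun v w =>
    ¬ Proportional (fun i => (v i).1) (fun i => (w i).1)) fun w hw =>
      isClosed_proportional.isOpen_compl.mem_nhds (hv w hw)
  filter_upwards [this] with u hu
  rintro ⟨w, hw, huw⟩
  exact hu w hw huw

end Forms

/-! ### Closed subsets of the Cremona group -/

section Closed

variable {k : Type*} [Field k] {n : ℕ}

/-- A power of `X 0` pads a tuple of minimal degree without changing the map. -/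
theorem exists_tuple_of_degree_le (g : RatMap k n) {d : ℕ} (hd : g.degree ≤ d) :
    ∃ (v : Tuple k n d) (hv : v ≠ 0), Rep.toRatMap ⟨d, v, hv⟩ = g := by
  have hne : {d | ∃ F : Rep k n, F.deg = d ∧ F.toRatMap = g}.Nonempty := by
    obtain ⟨F, hF⟩ := Quotient.exists_rep g
    exact ⟨F.deg, F, rfl, hF⟩
  obtain ⟨F, hFd, hF⟩ := Nat.sInf_mem hne
  have hle : F.deg ≤ d := hFd.trans_le hd
  have hmem : ∀ i, MvPolynomial.X 0 ^ (d - F.deg) * F.poly i ∈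
      MvPolynomial.homogeneousSubmodule (Fin (n + 1)) k d := fun i => by
    have h := ((MvPolynomial.isHomogeneous_X k (0 : Fin (n + 1))).pow (d - F.deg)).mul
      ((MvPolynomial.mem_homogeneousSubmodule _ _).1 (F.form i).2)
    rw [one_mul, Nat.sub_add_cancel hle] at h
    exact h
  refine ⟨fun i => ⟨_, hmem i⟩, fun h => F.poly_ne_zero (funext fun i => ?_), ?_⟩
  · have := congrArg Subtype.val (congrFun h i)
    exact (mul_eq_zero.1 this).resolve_left (pow_ne_zero _ (MvPolynomial.X_ne_zero _))
  · rw [← hF, Rep.toRatMap_eq_iff]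
    intro i j
    change MvPolynomial.X 0 ^ (d - F.deg) * F.poly i * F.poly j =
      MvPolynomial.X 0 ^ (d - F.deg) * F.poly j * F.poly i
    ring

theorem degree_toRatMap_le (F : Rep k n) : F.toRatMap.degree ≤ F.deg := Nat.sInf_le ⟨F, rfl, rfl⟩

variable [TopologicalSpace k]

theorem isClosed_bir {Q : Set (RatMap k n)}
    (hQ : ∀ d, IsClosed {v : {v : Tuple k n d // v ≠ 0} | Rep.toRatMap ⟨d, v.1, v.2⟩ ∈ Q}) :
    IsClosed {p : Bir k n | p.1 ∈ Q} := by
  refine isClosed_iSup_iff.2 fun d => isClosed_coinduced.2 (isClosed_coinduced.2 ?_)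
  have hW : IsClosed {h : W k n d.1 | h.toRatMap ∈ Q} := isClosed_coinduced.2 (hQ d.1)
  exact hW.preimage continuous_subtype_val

/-- The zero tuple is proportional to everything, so `0 ∉ K` is what lets proportionality to a
member of `K` mean equality of rational maps. -/
theorem isClosed_tuple_of_isCompact [IsTopologicalRing k] [T2Space k] {D : ℕ}
    {K : Set (Tuple k n D)} (hK : IsCompact K) (hK0 : 0 ∉ K) (d : ℕ) :
    IsClosed {v : {v : Tuple k n d // v ≠ 0} | Rep.toRatMap ⟨d, v.1, v.2⟩ ∈
      {g : RatMap k n | ∃ w ∈ K, ∃ hw : w ≠ 0, g = Rep.toRatMap ⟨D, w, hw⟩}} := by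
  have hcl : IsClosed {v : Tuple k n d |
      ∃ w ∈ K, Proportional (fun i => (v i).1) (fun i => (w i).1)} :=
    isClosed_exists_proportional hK
  convert hcl.preimage (continuous_subtype_val (p := fun v : Tuple k n d => v ≠ 0)) using 1
  ext v
  constructor
  · rintro ⟨w, hw, hw0, h⟩
    exact ⟨w, hw, Rep.toRatMap_eq_iff.1 h⟩
  · rintro ⟨w, hw, h⟩
    exact ⟨w, hw, fun h0 => hK0 (h0 ▸ hw), Rep.toRatMap_eq_iff.2 h⟩

theorem isClosed_bir_of_isCompact [IsTopologicalRing k] [T2Space k] {D : ℕ}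
    {K : Set (Tuple k n D)} (hK : IsCompact K) (hK0 : 0 ∉ K) :
    IsClosed {p : Bir k n | ∃ w ∈ K, ∃ hw : w ≠ 0, p.1 = Rep.toRatMap ⟨D, w, hw⟩} :=
  isClosed_bir (isClosed_tuple_of_isCompact hK hK0)

/-- The degrees of the members of a convergent sequence do not tend to infinity. -/
theorem exists_frequently_degree_le [IsTopologicalRing k] [T2Space k] {f : Bir k n}
    {fm : ℕ → Bir k n} (hf : Tendsto fm atTop (𝓝 f)) :
    ∃ D, ∃ᶠ m in atTop, (fm m).1.degree ≤ D := by
  by_contra! h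
  have hev : ∀ D, ∃ M, ∀ m ≥ M, D < (fm m).1.degree := fun D => by
    simpa [eventually_atTop] using h D
  obtain ⟨M, hM⟩ := hev f.1.degree
  -- Tuples of degree `d` only represent maps of degree at most `d`, hence members with index in a
  -- finite range. So this tail is closed and contains `f`, although all its degrees exceed that of
  -- `f`.
  have hcl : IsClosed {p : Bir k n | p.1 ∈ {g : RatMap k n | ∃ m, M ≤ m ∧ g = (fm m).1}} := by
    refine isClosed_bir fun d => ?_
    obtain ⟨M', hM'⟩ := hev d
    have hone : ∀ g : RatMap k n,
        IsClosed {v : {v : Tuple k n d // v ≠ 0} | Rep.toRatMap ⟨d, v.1, v.2⟩ = g} := by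
      intro g
      obtain ⟨w, hw, hg⟩ := exists_tuple_of_degree_le g le_rfl
      rw [← hg]
      convert isClosed_tuple_of_isCompact (isCompact_singleton (x := w))
        (fun h0 => hw (Set.mem_singleton_iff.1 h0).symm) d using 1
      ext v
      constructor
      · exact fun h => ⟨w, rfl, hw, h⟩
      · rintro ⟨w', rfl, _, h⟩
        exact h
    convert (Set.finite_Ico M M').isClosed_biUnion fun m _ => hone (fm m).1 using 1
    ext v
    simp only [Set.mem_ofPred_eq, Set.mem_iUnion, Set.mem_Ico, exists_prop]
    refine exists_congr fun m => ⟨fun ⟨h1, h2⟩ => ⟨⟨h1, ?_⟩, h2⟩, fun ⟨h1, h2⟩ => ⟨h1.1, h2⟩⟩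
    by_contra! hm
    have h3 := hM' m hm
    rw [← h2] at h3
    exact absurd (degree_toRatMap_le (⟨d, v.1, v.2⟩ : Rep k n)) (not_le.2 h3)
  obtain ⟨m, hm, hfm⟩ := hcl.mem_of_tendsto hf
    ((eventually_ge_atTop M).mono fun m hm => ⟨m, hm, rfl⟩)
  exact absurd (hM m hm) (by rw [← hfm]; exact lt_irrefl _)

/-- A convergent sequence of birational maps has a subsequence that lifts to a convergent sequence
of non-zero tuples of forms of a fixed degree, the limit of which is a lift of the limit. -/
theorem exists_subseq_tendsto_tuple [IsTopologicalDivisionRing k] [T2Space k]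
    [LocallyCompactSpace k] (hk : ¬ DiscreteTopology k) {f : Bir k n} {fm : ℕ → Bir k n}
    (hf : Tendsto fm atTop (𝓝 f)) :
    ∃ φ : ℕ → ℕ, StrictMono φ ∧ ∃ (D : ℕ) (v : ℕ → Tuple k n D) (hv : ∀ m, v m ≠ 0)
      (w : Tuple k n D) (hw : w ≠ 0), Tendsto v atTop (𝓝 w) ∧
        (∀ m, (fm (φ m)).1 = Rep.toRatMap ⟨D, v m, hv m⟩) ∧ f.1 = Rep.toRatMap ⟨D, w, hw⟩ := by
  have := firstCountableTopology_of_not_discrete hk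
  obtain ⟨D, hD⟩ := exists_frequently_degree_le hf
  obtain ⟨φ, hφ, hφD⟩ := extraction_of_frequently_atTop hD
  obtain ⟨C, hC, hC0, hCs⟩ := exists_isCompact_smul_mem hk (Tuple k n D)
  have hlift : ∀ m, ∃ v ∈ C, ∃ hv : v ≠ 0, (fm (φ m)).1 = Rep.toRatMap ⟨D, v, hv⟩ := by
    intro m
    obtain ⟨v, hv, hvf⟩ := exists_tuple_of_degree_le (fm (φ m)).1 (hφD m)
    obtain ⟨a, ha, hav⟩ := hCs v hv
    refine ⟨a • v, hav, smul_ne_zero ha hv, ?_⟩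
    rw [← hvf, Rep.toRatMap_eq_iff]
    intro i j
    change (v i).1 * (a • (v j).1) = (v j).1 * (a • (v i).1)
    rw [mul_smul_comm, mul_smul_comm, mul_comm]
  choose v hvC hv hvf using hlift
  obtain ⟨w, hwC, ψ, hψ, hvw⟩ := hC.isSeqCompact hvC
  have hne : ∀ u ∈ C, u ≠ 0 := fun u hu h0 => hC0 (h0 ▸ hu)
  refine ⟨φ ∘ ψ, hφ.comp hψ, D, v ∘ ψ, fun m => hv _, w, hne w hwC, hvw, fun m => hvf _, ?_⟩
  have hcl := isClosed_proportional (k := k) (n := n) (d := D) (d' := D)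
  -- A tail of the lifts together with its limit `w` is compact and avoids zero, so the maps it
  -- represents form a closed set, which contains `f`.
  have hK : ∀ M, ∃ u ∈ insert w (Set.range fun m => v (ψ (m + M))),
      ∃ hu : u ≠ 0, f.1 = Rep.toRatMap ⟨D, u, hu⟩ := by
    intro M
    have hlim : Tendsto (fun m => v (ψ (m + M))) atTop (𝓝 w) :=
      hvw.comp (tendsto_add_atTop_nat M)
    have h0 : 0 ∉ insert w (Set.range fun m => v (ψ (m + M))) := by
      rintro (h0 | ⟨m, hm⟩)
      · exact hne w hwC h0.symm
      · exact hv _ hm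
    have hcl := isClosed_bir_of_isCompact hlim.isCompact_insert_range h0
    have hlim' : Tendsto (fun m => fm (φ (ψ (m + M)))) atTop (𝓝 f) :=
      hf.comp ((hφ.comp hψ).tendsto_atTop.comp (tendsto_add_atTop_nat M))
    exact hcl.mem_of_tendsto hlim'
      (Eventually.of_forall fun m => ⟨_, Set.mem_insert_of_mem _ ⟨m, rfl⟩, hv _, hvf _⟩)
  by_contra hfw
  -- If `w` does not represent `f`, then lifts of arbitrarily large index do. They are all
  -- proportional to one of them and tend to `w`, so `w` is proportional to it too.
  have hK' : ∀ M, ∃ m, f.1 = Rep.toRatMap ⟨D, v (ψ (m + M)), hv _⟩ := by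
    intro M
    obtain ⟨u, rfl | ⟨m, rfl⟩, hu0, hu⟩ := hK M
    · exact absurd hu hfw
    · exact ⟨m, hu⟩
  choose m hm using hK'
  have hlim : Tendsto (fun M => v (ψ (m M + M))) atTop (𝓝 w) :=
    hvw.comp (tendsto_atTop_mono (fun M => Nat.le_add_left M _) tendsto_id)
  have hprop : ∀ M, Proportional (fun i => (v (ψ (m 0 + 0)) i).1)
      (fun i => (v (ψ (m M + M)) i).1) := fun M =>
    Rep.toRatMap_eq_iff.1 ((hm 0).symm.trans (hm M))
  have := hcl.mem_of_tendsto (tendsto_const_nhds.prodMk_nhds hlim) (Eventually.of_forall hprop)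
  exact hfw ((hm 0).trans (Rep.toRatMap_eq_iff.2 this))

end Closed

/-! ### Convergence of restrictions -/

section Convergence

theorem convergesLocallyUniformlyForAllMetrics_of_tendsto {U V : Type*} [TopologicalSpace U]
    [WeaklyLocallyCompactSpace U] [tV : TopologicalSpace V] {F : ℕ → C(U, V)} {g : C(U, V)}
    (h : Tendsto F atTop (𝓝 g)) :
    ConvergesLocallyUniformlyForAllMetrics (fun m => F m) g := by
  intro δ hδ p
  subst hδ
  obtain ⟨K, hK, hKp⟩ := exists_compact_mem_nhds p
  refine ⟨interior K, isOpen_interior, mem_interior_iff_mem_nhds.2 hKp, fun ε hε => ?_⟩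
  have := Metric.tendstoUniformlyOn_iff.1
    (ContinuousMap.tendsto_iff_forall_isCompact_tendstoUniformlyOn.1 h K hK) ε hε
  obtain ⟨N, hN⟩ := eventually_atTop.1 this
  refine ⟨N, fun m hm q hq => ?_⟩
  rw [dist_comm]
  exact hN m hm q (interior_subset hq)

variable {k : Type*} [Field k] [TopologicalSpace k] [IsTopologicalDivisionRing k] {n d : ℕ}

theorem isOpenQuotientMap_mk : IsOpenQuotientMap
    (fun v : {v : Fin (n + 1) → k // v ≠ 0} => Projectivization.mk k v.1 v.2) :=
  ⟨fun p => ⟨⟨p.rep, p.rep_nonzero⟩, p.mk_rep⟩, continuous_mk, isOpenMap_mk⟩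

instance locallyCompactSpace_projective [T2Space k] [LocallyCompactSpace k] :
    LocallyCompactSpace (PP k n) := by
  have : LocallyCompactSpace {v : Fin (n + 1) → k // v ≠ 0} :=
    (isOpen_compl_singleton (x := (0 : Fin (n + 1) → k))).locallyCompactSpace
  exact isOpenQuotientMap_mk.locallyCompactSpace

omit [TopologicalSpace k] [IsTopologicalDivisionRing k] in
theorem exists_tuple_eval_ne_zero [Infinite k] {w : Tuple k n d} (hw : w ≠ 0) :
    ∃ x : Fin (n + 1) → k, x ≠ 0 ∧ w.eval x ≠ 0 := by
  obtain ⟨i, hi⟩ := Function.ne_iff.1 hw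
  -- The factor `X 0` forces `x ≠ 0`, which non-vanishing of `w i` alone does not when `d = 0`.
  have hne : MvPolynomial.X 0 * (w i).1 ≠ 0 :=
    mul_ne_zero (MvPolynomial.X_ne_zero _) fun h => hi (Subtype.ext h)
  obtain ⟨x, hx⟩ : ∃ x, MvPolynomial.eval x (MvPolynomial.X 0 * (w i).1) ≠ 0 := by
    by_contra! h
    exact hne (MvPolynomial.funext fun x => by rw [h x, map_zero])
  rw [map_mul, MvPolynomial.eval_X] at hx
  exact ⟨x, fun h => left_ne_zero_of_mul hx (by rw [h]; rfl),
    fun h => right_ne_zero_of_mul hx (congrFun h i)⟩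

/-- The set of points of projective space with representatives in `A`. -/
def projImage (A : Set (Fin (n + 1) → k)) : Set (PP k n) :=
  (fun v : {v : Fin (n + 1) → k // v ≠ 0} => Projectivization.mk k v.1 v.2) ''
    (Subtype.val ⁻¹' A)

theorem isOpen_projImage {A : Set (Fin (n + 1) → k)} (hA : IsOpen A) : IsOpen (projImage A) :=
  isOpenMap_mk _ (hA.preimage continuous_subtype_val)

omit [TopologicalSpace k] [IsTopologicalDivisionRing k] in
theorem regularOn_projImage {A : Set (Fin (n + 1) → k)} {w : Tuple k n d} (hw : w ≠ 0)
    (h : ∀ x ∈ A, w.eval x ≠ 0) : (Rep.toRatMap ⟨d, w, hw⟩).RegularOn (projImage A) := by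
  rintro _ ⟨⟨x, hx⟩, hxA, rfl⟩
  exact ⟨⟨d, w, hw⟩, rfl, (Rep.eval_rep_ne_zero_iff _ x hx).2 (h x hxA)⟩

variable [T2Space k]

theorem restrict_mk {Ω : Set (PP k n)} (w : Tuple k n d) (hw : w ≠ 0)
    (h : (Rep.toRatMap ⟨d, w, hw⟩).RegularOn Ω) (x : Fin (n + 1) → k) (hx : x ≠ 0)
    (hxw : w.eval x ≠ 0) (hxΩ : Projectivization.mk k x hx ∈ Ω) :
    (Rep.toRatMap ⟨d, w, hw⟩).restrict Ω h ⟨Projectivization.mk k x hx, hxΩ⟩ =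
      Projectivization.mk k (w.eval x) hxw :=
  RatMap.value_eq ⟨d, w, hw⟩ x hx hxw (h _ hxΩ)

/-- The tuples of forms without common zeros in `A` act continuously on the points of `A`. -/
theorem continuous_restrict_projImage {A : Set (Fin (n + 1) → k)} (hA : IsOpen A) :
    Continuous fun u : {u : Tuple k n d // u ≠ 0 ∧ ∀ x ∈ A, u.eval x ≠ 0} =>
      (Rep.toRatMap ⟨d, u.1, u.2.1⟩).restrict (projImage A)
        (regularOn_projImage u.2.1 u.2.2) := by
  -- Joint continuity suffices. It is checked on representing vectors: `q` is an open quotient map,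
  -- so its product with the identity is again a quotient map.
  refine ContinuousMap.continuous_of_continuous_uncurry _ ?_
  let q : (Subtype.val ⁻¹' A : Set {v : Fin (n + 1) → k // v ≠ 0}) → projImage A := fun v =>
    ⟨Projectivization.mk k v.1.1 v.1.2, v.1, v.2, rfl⟩
  have hq : IsOpenQuotientMap q := by
    refine ⟨?_, ?_, ?_⟩
    · rintro ⟨_, v, hv, rfl⟩
      exact ⟨⟨v, hv⟩, rfl⟩
    · exact (continuous_mk.comp continuous_subtype_val).subtype_mk _
    · exact (isOpenMap_mk.comp
        (hA.preimage continuous_subtype_val).isOpenMap_subtype_val).subtype_mk _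
  refine ((IsOpenQuotientMap.id (X := {u : Tuple k n d // u ≠ 0 ∧ ∀ x ∈ A, u.eval x ≠ 0})).prodMap
    hq).continuous_comp_iff.1 ?_
  have hev : Continuous fun z : {u : Tuple k n d // u ≠ 0 ∧ ∀ x ∈ A, u.eval x ≠ 0} ×
      (Subtype.val ⁻¹' A : Set {v : Fin (n + 1) → k // v ≠ 0}) =>
      (⟨z.1.1.eval z.2.1.1, z.1.2.2 _ z.2.2⟩ : {v : Fin (n + 1) → k // v ≠ 0}) := by
    refine Continuous.subtype_mk ?_ _
    have h₁ : Continuous fun z : {u : Tuple k n d // u ≠ 0 ∧ ∀ x ∈ A, u.eval x ≠ 0} ×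
        (Subtype.val ⁻¹' A : Set {v : Fin (n + 1) → k // v ≠ 0}) => z.1.1 :=
      Continuous.subtype_val continuous_fst
    have h₂ : Continuous fun z : {u : Tuple k n d // u ≠ 0 ∧ ∀ x ∈ A, u.eval x ≠ 0} ×
        (Subtype.val ⁻¹' A : Set {v : Fin (n + 1) → k // v ≠ 0}) => z.2.1.1 :=
      Continuous.subtype_val (Continuous.subtype_val continuous_snd)
    exact Tuple.continuous_eval h₁ h₂
  refine (continuous_mk.comp hev).congr fun z => ?_
  exact (restrict_mk z.1.1 z.1.2.1 (regularOn_projImage z.1.2.1 z.1.2.2) z.2.1.1 z.2.1.2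
    (z.1.2.2 _ z.2.2) ⟨z.2.1, z.2.2, rfl⟩).symm

/-- If a sequence of tuples of forms converges, then the rational maps that it defines converge
uniformly on compact subsets of some non-empty open set. -/
theorem exists_isOpen_tendsto_restrict [LocallyCompactSpace k] [Infinite k] {v : ℕ → Tuple k n d}
    (hv : ∀ m, v m ≠ 0) {w : Tuple k n d} (hw : w ≠ 0) (hvw : Tendsto v atTop (𝓝 w)) :
    ∃ Ω : Set (PP k n), IsOpen Ω ∧ Ω.Nonempty ∧
      ∃ (N : ℕ) (hreg : (Rep.toRatMap ⟨d, w, hw⟩).RegularOn Ω)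
        (hregm : ∀ m, N ≤ m → (Rep.toRatMap ⟨d, v m, hv m⟩).RegularOn Ω),
        Tendsto (fun m => (Rep.toRatMap ⟨d, v (N + m), hv (N + m)⟩).restrict Ω
          (hregm (N + m) (Nat.le_add_right N m))) atTop
          (𝓝 ((Rep.toRatMap ⟨d, w, hw⟩).restrict Ω hreg)) := by
  obtain ⟨x, hx, hwx⟩ := exists_tuple_eval_ne_zero hw
  have hwc : Continuous (Tuple.eval w) :=
    Tuple.continuous_eval continuous_const continuous_id
  obtain ⟨K, hKx, hK0, hK⟩ := local_compact_nhds
    ((isOpen_compl_singleton.preimage hwc).mem_nhds hwx)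
  -- Compactness of `K` gives one neighbourhood of `w` that works for all `y ∈ K`.
  have hev : ∀ᶠ u in 𝓝 w, ∀ y ∈ K, u.eval y ≠ 0 :=
    hK.eventually_forall_of_forall_eventually (P := fun (u : Tuple k n d) y => u.eval y ≠ 0)
      fun y hy => (isOpen_compl_singleton.preimage
        (Tuple.continuous_eval continuous_fst continuous_snd)).mem_nhds (hK0 hy)
  obtain ⟨N, hN⟩ := eventually_atTop.1 (hvw.eventually hev)
  have hwA : ∀ y ∈ interior K, w.eval y ≠ 0 := fun y hy => hK0 (interior_subset hy)
  have hvA : ∀ m, N ≤ m → ∀ y ∈ interior K, (v m).eval y ≠ 0 := fun m hm y hy =>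
    hN m hm y (interior_subset hy)
  refine ⟨projImage (interior K), isOpen_projImage isOpen_interior,
    ⟨_, ⟨x, hx⟩, mem_interior_iff_mem_nhds.2 hKx, rfl⟩, N, regularOn_projImage hw hwA,
    fun m hm => regularOn_projImage (hv m) (hvA m hm), ?_⟩
  have hsub : Tendsto (fun m => (⟨v (N + m), hv _, hvA _ (Nat.le_add_right N m)⟩ :
      {u : Tuple k n d // u ≠ 0 ∧ ∀ x ∈ interior K, u.eval x ≠ 0})) atTop (𝓝 ⟨w, hw, hwA⟩) := by
    refine tendsto_subtype_rng.2 (hvw.comp ?_)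
    exact tendsto_atTop_mono (fun m => Nat.le_add_left m N) tendsto_id
  have hcont := (continuous_restrict_projImage (k := k) (n := n) (d := d)
    (isOpen_interior (s := K))).tendsto ⟨w, hw, hwA⟩
  have hlim := hcont.comp hsub
  exact hlim

end Convergence

end Cremona

theorem mainTheorem8 (k : Type*) [Field k] [TopologicalSpace k] [IsTopologicalDivisionRing k]
    [T2Space k] [LocallyCompactSpace k] (hk : ¬ DiscreteTopology k) (n : ℕ)
    (f : Cremona.Bir k n) (fm : ℕ → Cremona.Bir k n) (hf : Tendsto fm atTop (𝓝 f)) :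
    ∃ φ : ℕ → ℕ, StrictMono φ ∧
      ∃ Ω : Set (Cremona.PP k n), IsOpen Ω ∧ Ω.Nonempty ∧
        ∃ (N : ℕ) (hreg : f.1.RegularOn Ω) (hregm : ∀ m, N ≤ m → (fm (φ m)).1.RegularOn Ω),
          Tendsto (fun m => (fm (φ (N + m))).1.restrict Ω (hregm (N + m) (Nat.le_add_right N m)))
            atTop (𝓝 (f.1.restrict Ω hreg)) ∧
          Cremona.ConvergesLocallyUniformlyForAllMetrics
            (fun m => (fm (φ (N + m))).1.restrict Ω (hregm (N + m) (Nat.le_add_right N m)))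
            (f.1.restrict Ω hreg) := by
  have := Cremona.infinite_of_not_discrete hk
  obtain ⟨φ, hφ, D, v, hv, w, hw, hvw, hfm, hfw⟩ := Cremona.exists_subseq_tendsto_tuple hk hf
  refine ⟨φ, hφ, ?_⟩
  obtain ⟨Ω, hΩ, hΩn, N, hreg, hregm, hlim⟩ := Cremona.exists_isOpen_tendsto_restrict hv hw hvw
  -- Compact neighbourhoods in `Ω` turn uniform convergence on compact sets into local uniform
  -- convergence.
  have := hΩ.locallyCompactSpace
  refine ⟨Ω, hΩ, hΩn, N, hfw ▸ hreg, fun m hm => hfm m ▸ hregm m hm, ?_⟩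
  simp only [hfm, hfw]
  exact ⟨hlim, Cremona.convergesLocallyUniformlyForAllMetrics_of_tendsto hlim⟩
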